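/- Let $X$ be a topological space (no separation axiom is assumed) in which every singleton $\{x\}$ is a $G_\delta$-set, i.e. an intersection of countably many open sets. An open covering $\mathcal U$ of $X$ is called a $\mathcal K$-covering if for every compact $K\subseteq X$ there is $U\in\mathcal U$ with $K\subseteq U$; let $\mathcal K$ be the collection of all $\mathcal K$-coverings of $X$ and $\mathcal O$ the collection of all open coverings of $X$. In the game $G_1^{\omega_1}(\mathcal K,\mathcal O)$, at each inning $\xi<\omega_1$ player I chooses $\mathcal U_\xi\in\mathcal K$ and then player II chooses $U_\xi\in\mathcal U_\xi$; player II wins if $\{U_\xi:\xi<\omega_1\}\in\mathcal O$, that is, if the chosen sets cover $X$. A strategy for player II is a function $F$ that assigns to each sequence $(\mathcal U_\eta)_{\eta\le\xi}$ of $\mathcal K$-coverings with $\xi<\omega_1$ a member $F((\mathcal U_\eta)_{\eta\le\xi})$ of $\mathcal U_\xi$; it is winning if $\{F((\mathcal U_\eta)_{\eta\le\xi}):\xi<\omega_1\}$ covers $X$ for every sequence $(\mathcal U_\xi)_{\xi<\omega_1}$ of $\mathcal K$-coverings. If player II has a winning strategy in $G_1^{\omega_1}(\mathcal K,\mathcal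 O)$, then $|X|\le 2^{\aleph_0}$. -/

import Mathlib

universe u

/-- The family `𝒪` of all open coverings of `X`. -/
def openCovers (X : Type u) [TopologicalSpace X] : Set (Set (Set X)) :=
  {𝒰 | (∀ U ∈ 𝒰, IsOpen U) ∧ ⋃₀ 𝒰 = Set.univ}

/-- The family `𝒦` of all `𝒦`-coverings of `X`: the open coverings such that every compact
subset of `X` is contained in a single member. -/
def compactCovers (X : Type u) [TopologicalSpace X] : Set (Set (Set X)) :=
  {𝒰 | 𝒰 ∈ openCovers X ∧ ∀ K : Set X, IsCompact K → ∃ U ∈ 𝒰, K ⊆ U}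

/-- A strategy for player II in the game `G₁^κ(𝒜, ℬ)`, in which at each inning `ξ < κ` player I
chooses `A ξ ∈ 𝒜` and then player II chooses an element of `A ξ`. The answer at inning `ξ` depends
on the moves of player I at the innings `η ≤ ξ`. -/
structure StrategyII {α : Type u} (κ : Ordinal.{0}) (𝒜 : Set (Set α)) where
  /-- The element chosen at inning `ξ`. -/
  move : (ξ : Set.Iio κ) → (Set.Iic ξ → 𝒜) → α
  /-- The chosen element belongs to the last move of player I. -/
  move_mem : ∀ (ξ : Set.Iio κ) (φ : Set.Iic ξ → 𝒜), move ξ φ ∈ (φ ⟨ξ, Set.mem_Iic.2 le_rfl⟩ : Set α)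

/-- The strategy is winning in `G₁^κ(𝒜, ℬ)`: whatever player I plays, the set of the elements
chosen by player II is a member of `ℬ`. -/
def StrategyII.IsWinning {α : Type u} {κ : Ordinal.{0}} {𝒜 : Set (Set α)}
    (F : StrategyII κ 𝒜) (ℬ : Set (Set α)) : Prop :=
  ∀ A : Set.Iio κ → 𝒜, Set.range (fun ξ : Set.Iio κ => F.move ξ (fun η => A η)) ∈ ℬ

/-- Player II has a winning strategy in the game `G₁^κ(𝒜, ℬ)`. -/
def PlayerIIWins {α : Type u} (κ : Ordinal.{0}) (𝒜 ℬ : Set (Set α)) : Prop :=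
  ∃ F : StrategyII κ 𝒜, F.IsWinning ℬ

open Cardinal Set Filter Topology

/-!
Two facts about compact sets `K` drive the proof: `|K| ≤ 𝔠`, by Gryzlov's theorem, and hence `K` is
the intersection of at most `𝔠` open sets. For Gryzlov's theorem, let `H ⊆ K` be a set of at most
`𝔠` points that contains a cluster point of each of its sequences and meets each nonempty complement
of countably many chosen neighbourhoods of its points. Then `H` is countably compact, hence compact,
so a point outside `H` would be missed by finitely many chosen neighbourhoods covering `H`; their
complement is nonempty but does not meet `H`.

Fix a winning strategy for player II. At each position there is a compact set `K` such that every
open `V ⊇ K` is the answer to some move: otherwise the open sets which are never an answer would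
form a `𝒦`-covering, and the answer to it would be one of them. Restrict player I, at each position,
to at most `𝔠` moves whose answers intersect in a subset of `K`. At most `𝔠` positions remain,
because each inning has only countably many predecessors. If `y` were outside the compact sets
attached to these positions, player I could at every inning make an allowed move whose answer misses
`y`, and would win. So these at most `𝔠` compact sets cover the space.
-/

section Cardinality

universe v

theorem mk_iUnion_le_of_le {α : Type u} {ι : Type v} {μ : Cardinal.{u}} (hμ : ℵ₀ ≤ μ)
    (hι : lift.{u} #ι ≤ lift.{v} μ) {f : ι → Set α} (hf : ∀ i, #(f i) ≤ μ) :
    #(⋃ i, f i) ≤ μ := by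
  rw [← Cardinal.lift_le.{v}]
  calc
    lift.{v} #(⋃ i, f i) ≤ lift.{u} #ι * ⨆ i, lift.{v} #(f i) := mk_iUnion_le_lift f
    _ ≤ lift.{v} μ * lift.{v} μ := mul_le_mul' hι (ciSup_le' fun i => Cardinal.lift_le.2 (hf i))
    _ = lift.{v} μ := mul_eq_self (aleph0_le_lift.2 hμ)

theorem exists_superset_closed_under_operations {α : Type u} {ι : Type v}
    {μ : Cardinal.{max u v}} (hμ : 2 ≤ μ) (hpow : μ ^ ℵ₀ ≤ μ) (hι : lift.{u} #ι ≤ μ)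
    (op : ι → (ℕ → α) → α) {S : Set α} (hS : lift.{v} #S ≤ μ) :
    ∃ H ⊇ S, lift.{v} #H ≤ μ ∧ ∀ i s, (∀ n, s n ∈ H) → op i s ∈ H := by
  have hinf : ℵ₀ ≤ μ := (cantor ℵ₀).le.trans ((power_le_power_right hμ).trans hpow)
  let arity : S ⊕ ι → Type := Sum.elim (fun _ => Empty) fun _ => ℕ
  let eval : WType arity → α := WType.elim α fun
    | ⟨.inl a, _⟩ => a
    | ⟨.inr i, s⟩ => op i s
  have hterms : #(WType arity) ≤ μ := by
    refine WType.cardinalMk_le_of_le' ?_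
    have harity : ∀ o, μ ^ lift.{max u v} #(arity o) ≤ μ := by
      rintro (_ | _)
      · simpa [arity] using one_le_aleph0.trans hinf
      · simpa [arity] using hpow
    calc
      Cardinal.sum (fun o => μ ^ lift.{max u v} #(arity o)) ≤ Cardinal.sum fun _ : S ⊕ ι => μ :=
        sum_le_sum _ _ harity
      _ = (lift.{v} #S + lift.{u} #ι) * μ := by simp
      _ ≤ μ * μ := mul_le_mul_left (add_le_of_le hinf hS hι) μ
      _ = μ := mul_eq_self hinf
  refine ⟨range eval, fun a ha => ⟨WType.mk (.inl ⟨a, ha⟩) Empty.elim, rfl⟩, ?_, ?_⟩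
  · have hrange : lift.{max u v} #(range eval) ≤ lift.{u} #(WType arity) := mk_range_le_lift
    rw [← lift_umax]
    exact hrange.trans ((lift_id'.{u, max u v} _).trans_le hterms)
  · intro i s hs
    choose w hw using hs
    exact ⟨WType.mk (.inr i) w, congrArg (op i) (funext hw)⟩

theorem mk_Iio_Iio_ordinal {κ : Ordinal.{v}} (ξ : Iio κ) :
    #(Iio ξ) = lift.{v + 1} (ξ : Ordinal.{v}).card := by
  rw [← mk_Iio_ordinal, ← mk_image_eq Subtype.val_injective]
  simp

theorem continuum_power_le_continuum {c : Cardinal.{u}} (hc : 2 ^ c ≤ 𝔠) : 𝔠 ^ c ≤ 𝔠 :=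
  calc
    𝔠 ^ c = (2 ^ c) ^ ℵ₀ := by rw [← two_power_aleph0, ← power_mul, ← power_mul, mul_comm]
    _ ≤ 𝔠 ^ ℵ₀ := power_le_power_right hc
    _ = 𝔠 := continuum_power_aleph0

theorem two_power_card_le_continuum_of_lt_omega_one {ξ : Ordinal.{u}}
    (hξ : ξ < Ordinal.omega 1) : 2 ^ ξ.card ≤ 𝔠 := by
  rw [← ord_aleph, lt_ord, lt_aleph_one_iff] at hξ
  exact (power_le_power_left two_ne_zero hξ).trans two_power_aleph0.le

end Cardinality

section CompactSets

variable {X : Type u} [TopologicalSpace X]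

/-- The open families that witness the failure of compactness of `H`: no finite subfamily
covers `H`. -/
structure IsInadequate (H : Set X) (𝒱 : Set (Set X)) : Prop where
  isOpen : ∀ V ∈ 𝒱, IsOpen V
  not_subset_sUnion : ∀ 𝒯 ⊆ 𝒱, 𝒯.Finite → ¬ H ⊆ ⋃₀ 𝒯

theorem exists_maximal_isInadequate {H : Set X} (hH : ¬ IsCompact H) :
    ∃ 𝒱, Maximal (IsInadequate H) 𝒱 ∧ H ⊆ ⋃₀ 𝒱 := by
  obtain ⟨𝒲, h𝒲o, hcov, h𝒲⟩ : ∃ 𝒲 ⊆ {V : Set X | IsOpen V}, H ⊆ ⋃₀ 𝒲 ∧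
      ∀ 𝒯 ⊆ 𝒲, 𝒯.Finite → ¬ H ⊆ ⋃₀ 𝒯 := by
    contrapose! hH
    exact isCompact_generateFrom (TopologicalSpace.generateFrom_setOfPred_isOpen _).symm hH
  obtain ⟨𝒱, h𝒲𝒱, hmax⟩ := zorn_subset_nonempty {𝒱 | IsInadequate H 𝒱}
    (fun c hc hchain hne => ⟨⋃₀ c,
      { isOpen := fun V ⟨𝒱, h𝒱, hV⟩ => (hc h𝒱).isOpen V hV
        not_subset_sUnion := fun 𝒯 h𝒯 hfin =>
          have ⟨𝒱, h𝒱, h𝒯𝒱⟩ :=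
            hchain.directedOn.exists_mem_subset_of_finite_of_subset_sUnion hne hfin h𝒯
          (hc h𝒱).not_subset_sUnion 𝒯 h𝒯𝒱 hfin },
      fun _ => subset_sUnion_of_mem⟩) 𝒲 ⟨h𝒲o, h𝒲⟩
  exact ⟨𝒱, hmax, hcov.trans (sUnion_mono h𝒲𝒱)⟩

theorem IsInadequate.exists_notMem_sUnion [CompactSpace X] {H : Set X} {𝒱 : Set (Set X)}
    (h𝒱 : IsInadequate H 𝒱) : ∃ q, q ∉ ⋃₀ 𝒱 := by
  by_contra! hcov
  obtain ⟨𝒯, h𝒯, hfin, hsub⟩ := isCompact_univ.elim_finite_subcover_image (b := 𝒱) (c := id)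
    h𝒱.isOpen fun x _ => by simpa using hcov x
  exact h𝒱.not_subset_sUnion 𝒯 h𝒯 hfin <|
    (subset_univ H).trans (by simpa [sUnion_eq_biUnion] using hsub)

theorem IsInadequate.not_subset_sUnion_of_countable {H : Set X} {𝒱 𝒯 : Set (Set X)}
    (h𝒱 : IsInadequate H 𝒱) (hH : IsCountablyCompact H) (h𝒯 : 𝒯 ⊆ 𝒱) (hcount : 𝒯.Countable) :
    ¬ H ⊆ ⋃₀ 𝒯 := fun hcov => by
  obtain ⟨𝒮, h𝒮, hfin, hsub⟩ := hH.elim_finite_subcover_image hcount (U := id)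
    (fun V hV => h𝒱.isOpen V (h𝒯 hV)) (by rwa [sUnion_eq_biUnion] at hcov)
  exact h𝒱.not_subset_sUnion 𝒮 (h𝒮.trans h𝒯) hfin (by rwa [sUnion_eq_biUnion])

theorem exists_finite_subset_union_of_maximal_isInadequate {H U : Set X} {𝒱 : Set (Set X)}
    (hmax : Maximal (IsInadequate H) 𝒱) (hUo : IsOpen U) (hU : U ∉ 𝒱) :
    ∃ 𝒯 ⊆ 𝒱, 𝒯.Finite ∧ H ⊆ U ∪ ⋃₀ 𝒯 := by
  by_contra! hno
  have hins : IsInadequate H (insert U 𝒱) :=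
    { isOpen := forall_mem_insert.2 ⟨hUo, hmax.prop.isOpen⟩
      not_subset_sUnion := fun 𝒯 h𝒯 hfin hcov =>
        hno (𝒯 \ {U}) (by simpa [sdiff_singleton_subset_iff] using h𝒯) hfin.sdiff <| by
          rw [← sUnion_insert, insert_sdiff_singleton]
          exact hcov.trans (sUnion_mono (subset_insert _ _)) }
  exact hU (hmax.le_of_ge hins (subset_insert _ _) (mem_insert _ _))

/- Given a maximal open family without finite subcover of `H` and a point `q` outside it, finitely
many members cover the part of `H` outside each `U n`, where `{q} = ⋂ n, U n`; countably many
members therefore cover `H`. -/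
theorem isCompact_of_isCountablyCompact_of_isGδ [CompactSpace X]
    (hG : ∀ x : X, IsGδ ({x} : Set X)) {H : Set X} (hH : IsCountablyCompact H) :
    IsCompact H := by
  by_contra hcomp
  obtain ⟨𝒱, hmax, hcov⟩ := exists_maximal_isInadequate hcomp
  obtain ⟨q, hq⟩ := hmax.prop.exists_notMem_sUnion
  obtain ⟨U, hUo, hU⟩ := (hG q).eq_iInter_nat
  have hU𝒱 : ∀ n, U n ∉ 𝒱 := fun n hn =>
    hq ⟨U n, hn, mem_iInter.1 (hU ▸ mem_singleton q) n⟩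
  choose 𝒯 h𝒯 hfin hsub using fun n =>
    exists_finite_subset_union_of_maximal_isInadequate hmax (hUo n) (hU𝒱 n)
  refine hmax.prop.not_subset_sUnion_of_countable hH (iUnion_subset h𝒯)
    (countable_iUnion fun n => (hfin n).countable) fun z hz => ?_
  obtain ⟨n, hn⟩ : ∃ n, z ∉ U n := by
    have hzq : z ∉ ({q} : Set X) := fun h => hq (hcov (mem_singleton_iff.1 h ▸ hz))
    simpa [hU] using hzq
  exact sUnion_mono (subset_iUnion 𝒯 n) ((hsub n hz).resolve_left hn)

theorem exists_finset_cover_notMem {U : X → ℕ → Set X} {K : Set X} {y : X}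
    (hUo : ∀ x n, IsOpen (U x n)) (hU : ∀ x, {x} = ⋂ n, U x n) (hK : IsCompact K) (hy : y ∉ K) :
    ∃ t : Finset (K × ℕ), K ⊆ ⋃ z ∈ t, U z.1 z.2 ∧ ∀ z ∈ t, y ∉ U z.1 z.2 := by
  classical
  have hmiss : ∀ x : K, ∃ n, y ∉ U x n := fun x => by
    have hyx : y ∉ ({x.1} : Set X) := fun h => hy (mem_singleton_iff.1 h ▸ x.2)
    simpa [hU] using hyx
  choose k hk using hmiss
  obtain ⟨t, ht⟩ := hK.elim_finite_subcover (fun x : K => U x (k x)) (fun x => hUo x (k x))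
    fun x hx => mem_iUnion.2 ⟨⟨x, hx⟩, mem_iInter.1 (hU x ▸ mem_singleton x) _⟩
  exact ⟨t.image fun x => (x, k x), by rwa [Finset.set_biUnion_finset_image],
    Finset.forall_mem_image.2 fun x _ => hk x⟩

theorem isCountablyCompact_of_forall_seq_mem {H : Set X}
    (hH : ∀ s : ℕ → X, (∀ n, s n ∈ H) → ∃ z ∈ H, MapClusterPt z atTop s) :
    IsCountablyCompact H := by
  refine .of_seq_clusterPt fun s hs => ?_
  obtain ⟨N, hN⟩ := eventually_atTop.1 hs
  obtain ⟨z, hzH, hz⟩ := hH (fun n => s (n + N)) fun n => hN _ (Nat.le_add_left N n)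
  exact ⟨z, hzH, hz.of_comp (tendsto_add_atTop_nat N)⟩

theorem mk_le_continuum_of_compactSpace [CompactSpace X] (hG : ∀ x : X, IsGδ ({x} : Set X)) :
    #X ≤ 𝔠 := by
  rcases isEmpty_or_nonempty X with _ | hX
  · simp
  have ⟨a⟩ := hX
  choose U hUo hU using fun x => (hG x).eq_iInter_nat
  choose clusterPt hclusterPt using fun s : ℕ → X =>
    exists_clusterPt_of_compactSpace (map s atTop)
  choose! outside houtside using fun (e : ℕ → ℕ) (s : ℕ → X)
    (h : ∃ z, ∀ i, z ∉ U (s i) (e i)) => h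
  have one_le_continuum : (1 : Cardinal.{u}) ≤ 𝔠 := one_le_aleph0.trans aleph0_le_continuum
  obtain ⟨H, haH, hcard, hop⟩ := exists_superset_closed_under_operations
    (ι := Option (ℕ → ℕ)) (μ := 𝔠) (nat_lt_continuum 2).le continuum_power_aleph0.le
    (by simpa using add_le_of_le aleph0_le_continuum le_rfl one_le_continuum)
    (fun o => o.elim clusterPt outside) (S := {a}) (by simpa using one_le_continuum)
  rw [lift_uzero] at hcard
  have hH : IsCompact H := isCompact_of_isCountablyCompact_of_isGδ hG <|
    isCountablyCompact_of_forall_seq_mem fun s hs => ⟨_, hop none s hs, hclusterPt s⟩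
  suffices H = Set.univ by rwa [this, mk_univ] at hcard
  refine eq_univ_of_forall fun y => by_contra fun hy => ?_
  obtain ⟨t, hcov, hyt⟩ := exists_finset_cover_notMem hUo hU hH hy
  have ht : (t : Set (H × ℕ)).Nonempty := by
    obtain ⟨z, hz, -⟩ := mem_iUnion₂.1 (hcov (haH rfl))
    exact ⟨z, hz⟩
  obtain ⟨s, hs⟩ := t.countable_toSet.exists_eq_range ht
  have hys : ∀ i, y ∉ U (s i).1 (s i).2 := fun i =>
    hyt (s i) (Finset.mem_coe.1 (hs ▸ mem_range_self i))
  obtain ⟨z, hzt, hz⟩ := mem_iUnion₂.1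
    (hcov (hop (some fun i => (s i).2) (fun i => (s i).1) fun i => (s i).1.2))
  obtain ⟨i, rfl⟩ : z ∈ range s := hs ▸ hzt
  exact houtside _ _ ⟨y, hys⟩ i hz

theorem mk_le_continuum_of_isCompact (hG : ∀ x : X, IsGδ ({x} : Set X)) {K : Set X}
    (hK : IsCompact K) : #K ≤ 𝔠 := by
  have := isCompact_iff_compactSpace.1 hK
  refine mk_le_continuum_of_compactSpace fun x => ?_
  rw [← Subtype.val_injective.preimage_image {x}, image_singleton]
  exact (hG x).preimage continuous_subtype_val

theorem exists_isOpen_family_sInter_subset (hG : ∀ x : X, IsGδ ({x} : Set X)) {K : Set X}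
    (hK : IsCompact K) :
    ∃ 𝒱 : Set (Set X), #𝒱 ≤ max ℵ₀ #K ∧ (∀ V ∈ 𝒱, IsOpen V ∧ K ⊆ V) ∧ ⋂₀ 𝒱 ⊆ K := by
  classical
  choose U hUo hU using fun x => (hG x).eq_iInter_nat
  let W : Finset (K × ℕ) → Set X := fun t => ⋃ z ∈ t, U z.1 z.2
  refine ⟨{V ∈ range W | K ⊆ V}, ?_, ?_, fun y hyV => by_contra fun hy => ?_⟩
  · calc
      #{V ∈ range W | K ⊆ V} ≤ #(range W) := mk_le_mk_of_subset (sep_subset _ _)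
      _ ≤ #(Finset (K × ℕ)) := mk_range_le
      _ ≤ #(List (K × ℕ)) := mk_le_of_surjective List.toFinset_surjective
      _ ≤ max ℵ₀ #(K × ℕ) := mk_list_le_max _
      _ ≤ max ℵ₀ #K := by
        rw [mk_prod, lift_uzero, mk_nat, lift_aleph0]
        exact max_le (le_max_left _ _) <|
          mul_le_of_le (le_max_left _ _) (le_max_right _ _) (le_max_left _ _)
  · rintro _ ⟨⟨t, rfl⟩, hK⟩
    exact ⟨isOpen_biUnion fun z _ => hUo z.1 z.2, hK⟩
  · obtain ⟨t, hcov, hyt⟩ := exists_finset_cover_notMem hUo hU hK hy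
    obtain ⟨z, hzt, hz⟩ := mem_iUnion₂.1 (hyV (W t) ⟨mem_range_self t, hcov⟩)
    exact hyt z hzt hz

end CompactSets

section Tree

universe v

variable {I : Type v} {β : Type u} [Preorder I]

/-- The positions before inning `i` of a play in which each move belongs to the set that `M` allows
at the preceding position. -/
def treePositions (M : (i : I) → (Iio i → β) → Set β) (i : I) : Set (Iio i → β) :=
  {p | ∀ j : Iio i, p j ∈ M j fun k => p ⟨k, k.2.trans j.2⟩}

variable [WellFoundedLT I] {M : (i : I) → (Iio i → β) → Set β}

theorem mk_treePositions_le {μ : Cardinal.{u}} (hM : ∀ i p, #(M i p) ≤ μ) (i : I) :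
    #(treePositions M i) ≤ lift.{v} μ ^ lift.{u} #(Iio i) := by
  induction μ using Cardinal.inductionOn with | mk C
  let label (i : I) (p : Iio i → β) : M i p ↪ C := ((le_def _ _).1 (hM i p)).some
  let labels : treePositions M i → Iio i → C := fun p j => label j _ ⟨p.1 j, p.2 j⟩
  have hlabel : ∀ j r r', r = r' → ∀ (b : M j r) (b' : M j r'),
      label j r b = label j r' b' → (b : β) = b' := by
    rintro j r _ rfl b b' h
    exact congrArg Subtype.val ((label j r).injective h)
  have hinj : Function.Injective labels := fun p q hpq => by
    have heq : ∀ (j : I) (hj : j < i), p.1 ⟨j, hj⟩ = q.1 ⟨j, hj⟩ := fun j => by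
      induction j using WellFoundedLT.induction with
      | ind j ih =>
        exact fun hj => hlabel j _ _ (funext fun k => ih k k.2 _) _ _ (congrFun hpq ⟨j, hj⟩)
    exact Subtype.ext (funext fun j => heq j j.2)
  simpa using mk_le_of_injective hinj

theorem exists_branch (hM : ∀ i, ∀ p ∈ treePositions M i, (M i p).Nonempty) :
    ∃ g : I → β, ∀ i, g i ∈ M i fun j => g j := by
  rcases isEmpty_or_nonempty β with hβ | hβ
  · have hI : IsEmpty I := .mk fun i => by
      induction i using WellFoundedLT.induction with
      | ind i ih =>
        exact hβ.false (hM i (fun j => (ih j j.2).elim) fun j => (ih j j.2).elim).some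
    exact ⟨isEmptyElim, isEmptyElim⟩
  choose! next hnext using hM
  let g : I → β := IsWellFounded.fix (· < ·) fun _ g => next _ fun j => g j j.2
  have hg : ∀ i, g i = next i fun j => g j := IsWellFounded.fix_eq (· < ·) _
  refine ⟨g, fun i => ?_⟩
  induction i using WellFoundedLT.induction with
  | ind i ih => exact hg i ▸ hnext i _ fun j => ih j j.2

end Tree

section ExtendMoves

universe v

variable {I : Type v} {β : Type u} [PartialOrder I] {i : I}

/-- The moves of player I up to inning `i`: the moves `p` at the earlier innings, then `b`. -/
noncomputable def extendMoves (p : Iio i → β) (b : β) : Iic i → β :=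
  open Classical in fun j => if h : (j : I) < i then p ⟨j, h⟩ else b

theorem extendMoves_restrict (g : I → β) :
    extendMoves (fun j : Iio i => g j) (g i) = fun j : Iic i => g j := by
  funext j
  by_cases h : (j : I) < i
  · simp [extendMoves, h]
  · simp [extendMoves, eq_of_le_of_not_lt (mem_Iic.1 j.2) h]

theorem extendMoves_last (p : Iio i → β) (b : β) : extendMoves p b ⟨i, mem_Iic.2 le_rfl⟩ = b := by
  simp [extendMoves]

end ExtendMoves

section Game

variable {X : Type u} [TopologicalSpace X] {κ : Ordinal.{0}}

theorem mem_compactCovers_of_forall_isCompact {𝒰 : Set (Set X)} (ho : ∀ U ∈ 𝒰, IsOpen U)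
    (h𝒰 : ∀ K : Set X, IsCompact K → ∃ U ∈ 𝒰, K ⊆ U) : 𝒰 ∈ compactCovers X := by
  refine ⟨⟨ho, eq_univ_of_forall fun x => ?_⟩, h𝒰⟩
  obtain ⟨U, hU, hxU⟩ := h𝒰 {x} isCompact_singleton
  exact ⟨U, hU, hxU rfl⟩

theorem StrategyII.exists_isCompact_forall_exists_move_eq (F : StrategyII κ (compactCovers X))
    (ξ : Iio κ) (p : Iio ξ → compactCovers X) :
    ∃ K : Set X, IsCompact K ∧ ∀ V, IsOpen V → K ⊆ V → ∃ 𝒰, F.move ξ (extendMoves p 𝒰) = V := by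
  by_contra! hno
  let 𝒱 : Set (Set X) := {V | IsOpen V ∧ ∀ 𝒰, F.move ξ (extendMoves p 𝒰) ≠ V}
  have h𝒱 : 𝒱 ∈ compactCovers X :=
    mem_compactCovers_of_forall_isCompact (fun V hV => hV.1) fun K hK =>
      have ⟨V, hVo, hKV, hV⟩ := hno K hK
      ⟨V, ⟨hVo, hV⟩, hKV⟩
  have hmem := F.move_mem ξ (extendMoves p ⟨𝒱, h𝒱⟩)
  rw [extendMoves_last] at hmem
  exact hmem.2 _ rfl

theorem StrategyII.IsWinning.iUnion_treePositions_eq_univ {𝒜 : Set (Set (Set X))}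
    {F : StrategyII κ 𝒜} (hF : F.IsWinning (openCovers X))
    {K : (ξ : Iio κ) → (Iio ξ → 𝒜) → Set X} {M : (ξ : Iio κ) → (Iio ξ → 𝒜) → Set 𝒜}
    (hM : ∀ ξ p, ∀ y ∉ K ξ p, ∃ 𝒰 ∈ M ξ p, y ∉ F.move ξ (extendMoves p 𝒰)) :
    ⋃ ξ, ⋃ p : treePositions M ξ, K ξ p = Set.univ := by
  refine eq_univ_of_forall fun y => by_contra fun hy => ?_
  simp only [mem_iUnion, not_exists] at hy
  obtain ⟨g, hg⟩ := exists_branch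
    (M := fun ξ p => {𝒰 ∈ M ξ p | y ∉ F.move ξ (extendMoves p 𝒰)}) fun ξ p hp =>
      hM ξ p y (hy ξ ⟨p, fun η => (hp η).1⟩)
  obtain ⟨_, ⟨ξ, rfl⟩, hξ⟩ : y ∈ ⋃₀ range fun ξ => F.move ξ fun η => g η :=
    (hF g).2 ▸ mem_univ y
  refine (hg ξ).2 ?_
  rwa [extendMoves_restrict]

theorem mk_le_of_playerIIWins {μ : Cardinal.{u}} (hμ : ℵ₀ ≤ μ) (hκ : lift.{u} κ.card ≤ μ)
    (hpow : ∀ ξ < κ, μ ^ lift.{u} ξ.card ≤ μ) (hcard : ∀ K : Set X, IsCompact K → #K ≤ μ)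
    (hopen : ∀ K : Set X, IsCompact K →
      ∃ 𝒱 : Set (Set X), #𝒱 ≤ μ ∧ (∀ V ∈ 𝒱, IsOpen V ∧ K ⊆ V) ∧ ⋂₀ 𝒱 ⊆ K)
    (hII : PlayerIIWins κ (compactCovers X) (openCovers X)) : #X ≤ μ := by
  obtain ⟨F, hF⟩ := hII
  choose K hK hmove using F.exists_isCompact_forall_exists_move_eq
  choose 𝒱 h𝒱card h𝒱 h𝒱K using fun ξ p => hopen (K ξ p) (hK ξ p)
  choose 𝒰 h𝒰 using fun ξ p (V : 𝒱 ξ p) => hmove ξ p V (h𝒱 ξ p V V.2).1 (h𝒱 ξ p V V.2).2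
  let M : (ξ : Iio κ) → (Iio ξ → compactCovers X) → Set (compactCovers X) :=
    fun ξ p => range (𝒰 ξ p)
  have hcover : ⋃ ξ, ⋃ p : treePositions M ξ, K ξ p = Set.univ :=
    hF.iUnion_treePositions_eq_univ fun ξ p y hy => by
      obtain ⟨V, hV, hyV⟩ : ∃ V ∈ 𝒱 ξ p, y ∉ V := by
        simpa using mt (@h𝒱K ξ p y) hy
      exact ⟨𝒰 ξ p ⟨V, hV⟩, mem_range_self _, by rwa [h𝒰]⟩
  have hpositions : ∀ ξ, #(treePositions M ξ) ≤ lift.{1} μ := fun ξ =>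
    (mk_treePositions_le (fun ξ p => mk_range_le.trans (h𝒱card ξ p)) ξ).trans <| by
      rw [mk_Iio_Iio_ordinal]
      simpa only [lift_power, lift_lift] using Cardinal.lift_le.{1}.2 (hpow ξ ξ.2)
  rw [← mk_univ, ← hcover]
  refine mk_iUnion_le_of_le hμ ?_ fun ξ => mk_iUnion_le_of_le hμ ?_ fun p => hcard _ (hK ξ p)
  · rw [mk_Iio_ordinal]
    simpa only [lift_lift] using Cardinal.lift_le.{1}.2 hκ
  · rw [lift_id'.{u, 1}, lift_umax.{u, 1}]
    exact hpositions ξ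

end Game

theorem theorem2p9_general {X : Type u} [TopologicalSpace X] (hG : ∀ x : X, IsGδ ({x} : Set X))
    {κ : Ordinal.{0}} (hκ : ∀ ξ < κ, 2 ^ ξ.card ≤ 𝔠)
    (hII : PlayerIIWins κ (compactCovers X) (openCovers X)) : #X ≤ 𝔠 := by
  have hκcard : κ.card ≤ 𝔠 := by
    by_contra! h
    have hpow : 2 ^ 𝔠 ≤ 𝔠 := by
      simpa using hκ (ord 𝔠) ((ord_lt_ord.2 h).trans_le (ord_card_le κ))
    exact (cantor 𝔠).not_ge hpow
  refine mk_le_of_playerIIWins aleph0_le_continuum (lift_le_continuum.2 hκcard) ?_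
    (fun K => mk_le_continuum_of_isCompact hG) (fun K hK => ?_) hII
  · refine fun ξ hξ => continuum_power_le_continuum ?_
    rw [← lift_two_power]
    exact lift_le_continuum.2 (hκ ξ hξ)
  · obtain ⟨𝒱, hcard, h𝒱⟩ := exists_isOpen_family_sInter_subset hG hK
    exact ⟨𝒱, hcard.trans (max_le aleph0_le_continuum (mk_le_continuum_of_isCompact hG hK)), h𝒱⟩

theorem theorem2p9 (X : Type u) [TopologicalSpace X] (hG : ∀ x : X, IsGδ ({x} : Set X))
    (hII : PlayerIIWins (Ordinal.omega 1) (compactCovers X) (openCovers X)) :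
    Cardinal.mk X ≤ 2 ^ Cardinal.aleph0 := by
  rw [two_power_aleph0]
  exact theorem2p9_general hG (fun _ => two_power_card_le_continuum_of_lt_omega_one) hII
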